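/- Let $\mathcal H_A,\mathcal H_B$ be complex Hilbert spaces and $\mathcal H=\mathcal H_A\otimes\mathcal H_B$ their Hilbert space tensor product. Let $\mathcal S$ be the set of separable states, i.e. the closure in trace norm of the convex hull of all $|\psi_A\otimes\psi_B\rangle\langle\psi_A\otimes\psi_B|$ with unit vectors $\psi_A\in\mathcal H_A$, $\psi_B\in\mathcal H_B$. Let $\mathcal D(\mathcal H)$ be the set of density operators. For $\rho\in\mathcal D(\mathcal H)$ define the generalized robustness of entanglement $\underline{R}_{\mathcal S}(\rho)\in[1,\infty]$ as the infimum of all $1+\lambda$, $\lambda\ge 0$, for which there exist bounded operators $\xi_k$ with $\|\xi_k-\rho\|_1\to 0$ and $\tau_k\in\mathcal D(\mathcal H)$ such that $\frac{\xi_k+\lambda\tau_k}{1+\lambda}\in\mathcal S$ for all $k$. Let $R_{\mathcal S}(\rho)$ be the infimum of all $1+\lambda$, $\lambda\ge0$, for which there exists $\tau\in\mathcal D(\mathcal H)$ with $\frac{\rho+\lambda\tau}{1+\lambda}\in\mathcal S$. In both cases $\inf\emptyset=\infty$. (1) Let $\psi\in\mathcal H$ be a unit vector with Schmidt decomposition $\psi=\sum_n\mu_n\,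 e_n\otimes f_n$, where $\mu_n\ge 0$, $(e_n)$ is an orthonormal family in $\mathcal H_A$ and $(f_n)$ is an orthonormal family in $\mathcal H_B$ (over any common index set, for instance $n=1,2,\dots$). Then $$\underline{R}_{\mathcal S}(|\psi\rangle\langle\psi|)=R_{\mathcal S}(|\psi\rangle\langle\psi|)=\Big(\sum_n\mu_n\Big)^2\in[1,\infty].$$ In particular $\underline{R}_{\mathcal S}(|\psi\rangle\langle\psi|)<\infty$ if and only if $\sum_n\mu_n$ converges. (2) Let $(|n\rangle)_{n\ge0}$ denote orthonormal (Fock) bases of $\mathcal H_A$ and of $\mathcal H_B$, and for $r\ge0$ let $$|\nu_r\rangle=e^{\frac r2(a^\dagger b^\dagger-ab)}|00\rangle=\frac{1}{\cosh(r/2)}\sum_{n=0}^\infty\tanh^n(r/2)\,|nn\rangle$$ be the two-mode squeezed vacuum, the Fock expansion on the right being taken as its definition. Then $\nu_r$ is a unit vector and $\underline{R}_{\mathcal S}(|\nu_r\rangle\langle\nu_r|)=R_{\mathcal S}(|\nu_r\rangle\langle\nu_r|)=e^r$. -/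

import Mathlib

open scoped TensorProduct InnerProductSpace ENNReal Topology
open Filter

noncomputable section

namespace QuantumRobustness

section General

variable {K : Type*} [NormedAddCommGroup K] [InnerProductSpace ℂ K] [CompleteSpace K]

/-- The trace of a positive operator `T`, with values in `[0, ∞]`: the supremum of the sums
`∑ ⟨x, T x⟩` over finite orthonormal families. For `T ≥ 0` this is `∑ ⟨b i, T (b i)⟩` for each
orthonormal basis `b` of `K`. Only used for positive operators. -/
def posTrace (T : K →L[ℂ] K) : ℝ≥0∞ :=
  ⨆ (s : Finset K) (_ : Orthonormal ℂ (fun x : s => (x : K))),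
    ∑ x ∈ s, ENNReal.ofReal (⟪x, T x⟫_ℂ).re

/-- The trace norm `‖T‖₁ = Tr |T|`, where `|T| = (T† T)^(1/2)`. It is `∞` exactly when the bounded
operator `T` is not of trace class. -/
def traceNorm (T : K →L[ℂ] K) : ℝ≥0∞ := posTrace (CFC.abs T)

/-- Density operators: positive operators of trace one. -/
def densityOperators (K : Type*) [NormedAddCommGroup K] [InnerProductSpace ℂ K]
    [CompleteSpace K] : Set (K →L[ℂ] K) :=
  {T | T.IsPositive ∧ posTrace T = 1}

/-- The closure of a set of operators with respect to the trace norm. -/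
def traceClosure (C : Set (K →L[ℂ] K)) : Set (K →L[ℂ] K) :=
  {T | ∀ ε : ℝ≥0∞, 0 < ε → ∃ S ∈ C, traceNorm (T - S) < ε}

/-- The closed convex hull `cl conv C`, the closure being taken in the trace norm. -/
def traceClosedConvexHull (C : Set (K →L[ℂ] K)) : Set (K →L[ℂ] K) :=
  traceClosure (convexHull ℝ C)

/-- The operator `|ψ⟩⟨ψ|`. -/
def proj (ψ : K) : K →L[ℂ] K := InnerProductSpace.rankOne ℂ ψ ψ

/-- The generalized robustness of `ρ` with respect to the free set `F`, without sequences: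
the infimum of `1 + r`, `r ≥ 0`, such that `(ρ + r τ) / (1 + r) ∈ F` for some density
operator `τ`. The infimum over the empty set is `∞`. -/
def plainRobustness (F : Set (K →L[ℂ] K)) (ρ : K →L[ℂ] K) : ℝ≥0∞ :=
  sInf {x : ℝ≥0∞ | ∃ r : ℝ, 0 ≤ r ∧ x = ENNReal.ofReal (1 + r) ∧
    ∃ τ ∈ densityOperators K, ((1 + r : ℝ) : ℂ)⁻¹ • (ρ + (r : ℂ) • τ) ∈ F}

/-- The generalized robustness of `ρ` with respect to the free set `F`:
the infimum of `1 + r`, `r ≥ 0`, such that there are bounded operators `ξ k` converging to `ρ` in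
trace norm and density operators `τ k` with `(ξ k + r τ k) / (1 + r) ∈ F` for all `k`.
The infimum over the empty set is `∞`. -/
def robustness (F : Set (K →L[ℂ] K)) (ρ : K →L[ℂ] K) : ℝ≥0∞ :=
  sInf {x : ℝ≥0∞ | ∃ r : ℝ, 0 ≤ r ∧ x = ENNReal.ofReal (1 + r) ∧
    ∃ ξ τ : ℕ → (K →L[ℂ] K), Tendsto (fun k => traceNorm (ξ k - ρ)) atTop (𝓝 0) ∧
      ∀ k, τ k ∈ densityOperators K ∧ ((1 + r : ℝ) : ℂ)⁻¹ • (ξ k + (r : ℂ) • τ k) ∈ F}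

end General

section Bipartite

/-- The Hilbert space tensor product: the completion of the algebraic tensor product with respect
to the inner product `⟨a ⊗ b, a' ⊗ b'⟩ = ⟨a, a'⟩ ⟨b, b'⟩`. -/
abbrev HilbertTensor (A B : Type*) [NormedAddCommGroup A] [InnerProductSpace ℂ A]
    [NormedAddCommGroup B] [InnerProductSpace ℂ B] : Type _ :=
  UniformSpace.Completion (A ⊗[ℂ] B)

variable {A B : Type*} [NormedAddCommGroup A] [InnerProductSpace ℂ A]
  [NormedAddCommGroup B] [InnerProductSpace ℂ B]

/-- The product vector `a ⊗ b` in the Hilbert space tensor product. -/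
def tensorVec (a : A) (b : B) : HilbertTensor A B := ((a ⊗ₜ[ℂ] b : A ⊗[ℂ] B) : HilbertTensor A B)

/-- Separable states: the trace norm closed convex hull of the pure product states. -/
def separableStates (A B : Type*) [NormedAddCommGroup A] [InnerProductSpace ℂ A]
    [NormedAddCommGroup B] [InnerProductSpace ℂ B] :
    Set (HilbertTensor A B →L[ℂ] HilbertTensor A B) :=
  traceClosedConvexHull
    {T | ∃ (a : A) (b : B), ‖a‖ = 1 ∧ ‖b‖ = 1 ∧ T = proj (tensorVec a b)}

/-- `ψ = ∑ μ n • (e n ⊗ f n)` is a Schmidt decomposition of the vector `ψ`. -/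
structure IsSchmidtDecomposition {ι : Type*} (ψ : HilbertTensor A B) (μ : ι → ℝ)
    (e : ι → A) (f : ι → B) : Prop where
  nonneg : ∀ n, 0 ≤ μ n
  orthonormal_left : Orthonormal ℂ e
  orthonormal_right : Orthonormal ℂ f
  hasSum : HasSum (fun n => (μ n : ℂ) • tensorVec (e n) (f n)) ψ

/-- The two-mode squeezed vacuum state vector
`exp ((r / 2) (a† b† - a b)) |00⟩ = (cosh (r / 2))⁻¹ ∑ (tanh (r / 2)) ^ n |nn⟩`,
where `|n⟩` are the Fock bases `b₁` and `b₂` of the two modes. -/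
def twoModeSqueezedVacuum (b₁ : HilbertBasis ℕ ℂ A) (b₂ : HilbertBasis ℕ ℂ B) (r : ℝ) :
    HilbertTensor A B :=
  ∑' n : ℕ, ((Real.tanh (r / 2) ^ n / Real.cosh (r / 2) : ℝ) : ℂ) • tensorVec (b₁ n) (b₂ n)

end Bipartite

end QuantumRobustness

end

/-!
Lower bound: for finite `s`, the vector `φ = ∑ n ∈ s, e n ⊗ f n` has overlap at most `1` with
every product unit vector, by Cauchy–Schwarz and Bessel. The trace norm dominates the operator norm,
so `⟨φ, σ φ⟩ ≤ 1` for every separable `σ`, whereas `⟨φ, ψ⟩ = ∑ n ∈ s, μ n`. Evaluating `⟨φ, · φ⟩` on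
`ξ k + r τ k` and letting `k → ∞` gives `(∑ n ∈ s, μ n) ^ 2 ≤ 1 + r`.

Upper bound: if `M = ∑ μ n` is finite, then `σ = M⁻¹ ∑ μ n |e n ⊗ f n⟩⟨e n ⊗ f n|` is separable, and
`|ψ⟩⟨ψ| ≤ M ^ 2 σ` by Cauchy–Schwarz with weights `μ n`. The normalization of `M ^ 2 σ - |ψ⟩⟨ψ|`
serves as `τ`.
-/

namespace QuantumRobustness

section Expectation

variable {K : Type*} [NormedAddCommGroup K] [InnerProductSpace ℂ K]

/-- The expectation value `Re ⟨x, T x⟩`, as a continuous real-linear functional of the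
operator `T`. -/
noncomputable def expectation (x : K) : (K →L[ℂ] K) →L[ℝ] ℝ :=
  Complex.reCLM ∘L ((innerSL ℂ x) ∘L ContinuousLinearMap.apply ℂ K x).restrictScalars ℝ

theorem expectation_apply (x : K) (T : K →L[ℂ] K) : expectation x T = (⟪x, T x⟫_ℂ).re := rfl

theorem expectation_proj (x ψ : K) : expectation x (proj ψ) = ‖⟪ψ, x⟫_ℂ‖ ^ 2 := by
  rw [expectation_apply, proj, InnerProductSpace.rankOne_apply, inner_smul_right,
    ← inner_conj_symm x ψ, Complex.mul_conj']
  norm_cast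

theorem expectation_nonneg {T : K →L[ℂ] K} (hT : 0 ≤ T) (x : K) : 0 ≤ expectation x T :=
  ((ContinuousLinearMap.nonneg_iff_isPositive T).1 hT).re_inner_nonneg_right x

theorem expectation_mono {S T : K →L[ℂ] K} (h : S ≤ T) (x : K) :
    expectation x S ≤ expectation x T := by
  have hsub := ((ContinuousLinearMap.le_def S T).1 h).re_inner_nonneg_right x
  rw [← sub_nonneg, ← map_sub]
  exact hsub

theorem proj_nonneg (ψ : K) : 0 ≤ proj ψ :=
  (ContinuousLinearMap.nonneg_iff_isPositive _).2 (InnerProductSpace.isPositive_rankOne_self ψ)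

variable [CompleteSpace K]

theorem le_of_expectation_le {S T : K →L[ℂ] K} (hS : IsSelfAdjoint S) (hT : IsSelfAdjoint T)
    (h : ∀ x, expectation x S ≤ expectation x T) : S ≤ T := by
  refine (ContinuousLinearMap.le_def S T).2
    (ContinuousLinearMap.isPositive_def'.2 ⟨hT.sub hS, fun x => ?_⟩)
  rw [ContinuousLinearMap.reApplyInnerSelf_apply, inner_re_symm]
  have hsub := sub_nonneg.2 (h x)
  rwa [← map_sub] at hsub

theorem expectation_eq_norm_sqrt_sq {T : K →L[ℂ] K} (hT : 0 ≤ T) (x : K) :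
    expectation x T = ‖CFC.sqrt T x‖ ^ 2 := by
  have hsymm := (CFC.sqrt_nonneg T).isSelfAdjoint.isSymmetric.apply_clm
  have hsqrt : T x = CFC.sqrt T (CFC.sqrt T x) := by
    rw [← mul_apply_eq_comp, CFC.sqrt_mul_sqrt_self T hT]
  rw [expectation_apply, hsqrt, ← hsymm]
  exact inner_self_eq_norm_sq (𝕜 := ℂ) _

theorem ofReal_expectation {T : K →L[ℂ] K} (hT : 0 ≤ T) (x : K) :
    ENNReal.ofReal (expectation x T) = ‖CFC.sqrt T x‖ₑ ^ 2 := by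
  rw [expectation_eq_norm_sqrt_sq hT, ENNReal.ofReal_pow (norm_nonneg _), ofReal_norm]

end Expectation

section Trace

variable {K ι : Type*} [NormedAddCommGroup K] [InnerProductSpace ℂ K]

theorem tsum_enorm_inner_sq (b : HilbertBasis ι ℂ K) (x : K) :
    ∑' i, ‖⟪b i, x⟫_ℂ‖ₑ ^ 2 = ‖x‖ₑ ^ 2 := by
  have hsum : HasSum (fun i => ‖⟪b i, x⟫_ℂ‖ ^ 2) (‖x‖ ^ 2) := by
    have h := Complex.hasSum_re (b.hasSum_inner_mul_inner x x)
    rw [inner_self_eq_norm_sq_to_K] at h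
    convert h using 1
    · ext i
      rw [← inner_conj_symm x (b i), Complex.conj_mul']
      norm_cast
    · norm_cast
  simp_rw [← ofReal_norm, ← ENNReal.ofReal_pow (norm_nonneg _)]
  rw [← hsum.tsum_eq, ENNReal.ofReal_tsum_of_nonneg (fun _ => by positivity) hsum.summable]

theorem sum_enorm_inner_sq_le {g : ι → K} (hg : Orthonormal ℂ g) (s : Finset ι) (x : K) :
    ∑ i ∈ s, ‖⟪g i, x⟫_ℂ‖ₑ ^ 2 ≤ ‖x‖ₑ ^ 2 := by
  simp_rw [← ofReal_norm, ← ENNReal.ofReal_pow (norm_nonneg _)]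
  rw [← ENNReal.ofReal_sum_of_nonneg fun _ _ => by positivity]
  exact ENNReal.ofReal_le_ofReal (hg.sum_inner_products_le x)

theorem sum_ofReal_expectation_le_posTrace {g : ι → K} (hg : Orthonormal ℂ g) (s : Finset ι)
    (T : K →L[ℂ] K) : ∑ i ∈ s, ENNReal.ofReal (expectation (g i) T) ≤ posTrace T := by
  classical
  have horth : Orthonormal ℂ (fun x : s.image g => (x : K)) := by
    refine hg.toSubtypeRange.comp (fun x : s.image g => ⟨x, ?_⟩) fun x y h =>
      Subtype.ext (Subtype.mk.inj h)
    obtain ⟨i, -, hi⟩ := Finset.mem_image.1 x.2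
    exact ⟨i, hi⟩
  rw [← Finset.sum_image (f := fun x => ENNReal.ofReal (expectation x T))
    fun _ _ _ _ h => hg.linearIndependent.injective h]
  exact le_iSup₂ (f := fun (s : Finset K) (_ : Orthonormal ℂ fun x : s => (x : K)) =>
    ∑ x ∈ s, ENNReal.ofReal (⟪x, T x⟫_ℂ).re) (s.image g) horth

theorem posTrace_smul {c : ℝ} (hc : 0 ≤ c) (T : K →L[ℂ] K) :
    posTrace (c • T) = ENNReal.ofReal c * posTrace T := by
  simp_rw [posTrace, ENNReal.mul_iSup, Finset.mul_sum, ← expectation_apply, map_smul, smul_eq_mul,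
    ENNReal.ofReal_mul hc]

theorem posTrace_mono {S T : K →L[ℂ] K} (h : S ≤ T) : posTrace S ≤ posTrace T :=
  iSup₂_mono fun _ _ => Finset.sum_le_sum fun x _ =>
    ENNReal.ofReal_le_ofReal (expectation_mono h x)

variable [CompleteSpace K]

theorem posTrace_eq_tsum (b : HilbertBasis ι ℂ K) {T : K →L[ℂ] K} (hT : 0 ≤ T) :
    posTrace T = ∑' i, ENNReal.ofReal (expectation (b i) T) := by
  apply le_antisymm
  · refine iSup₂_le fun s hs => ?_
    have hsymm := (CFC.sqrt_nonneg T).isSelfAdjoint.isSymmetric.apply_clm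
    calc ∑ x ∈ s, ENNReal.ofReal (expectation x T)
        = ∑ x ∈ s, ∑' i, ‖⟪b i, CFC.sqrt T x⟫_ℂ‖ₑ ^ 2 := by
          simp_rw [ofReal_expectation hT, tsum_enorm_inner_sq]
      _ = ∑' i, ∑ x ∈ s, ‖⟪b i, CFC.sqrt T x⟫_ℂ‖ₑ ^ 2 :=
          (Summable.tsum_finsetSum fun _ _ => ENNReal.summable).symm
      _ ≤ ∑' i, ‖CFC.sqrt T (b i)‖ₑ ^ 2 := by
          refine ENNReal.tsum_le_tsum fun i => ?_
          rw [← Finset.sum_coe_sort]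
          convert sum_enorm_inner_sq_le hs Finset.univ (CFC.sqrt T (b i)) using 3 with x
          rw [← hsymm, ← ofReal_norm, norm_inner_symm, ofReal_norm]
      _ = ∑' i, ENNReal.ofReal (expectation (b i) T) := by simp_rw [ofReal_expectation hT]
  · rw [ENNReal.tsum_eq_iSup_sum]
    exact iSup_le fun s => sum_ofReal_expectation_le_posTrace b.orthonormal s T

theorem posTrace_of_hasSum {T : ι → K →L[ℂ] K} {S : K →L[ℂ] K} (hT : ∀ n, 0 ≤ T n)
    (hS : HasSum T S) : posTrace S = ∑' n, posTrace (T n) := by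
  obtain ⟨w, b, -⟩ := exists_hilbertBasis ℂ K
  rw [posTrace_eq_tsum b (hS.nonneg hT)]
  simp_rw [posTrace_eq_tsum b (hT _)]
  rw [ENNReal.tsum_comm]
  refine tsum_congr fun i => ?_
  have hsum := hS.mapL (expectation (b i))
  rw [← hsum.tsum_eq,
    ENNReal.ofReal_tsum_of_nonneg (fun n => expectation_nonneg (hT n) _) hsum.summable]

theorem posTrace_add {S T : K →L[ℂ] K} (hS : 0 ≤ S) (hT : 0 ≤ T) :
    posTrace (S + T) = posTrace S + posTrace T := by
  have h := posTrace_of_hasSum (T := fun i : Bool => cond i S T) (by simp [hS, hT])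
    (hasSum_fintype _)
  simpa using h

theorem posTrace_sub {S T : K →L[ℂ] K} (hS : 0 ≤ S) (hST : S ≤ T) (htop : posTrace S ≠ ⊤) :
    posTrace (T - S) = posTrace T - posTrace S := by
  refine ENNReal.eq_sub_of_add_eq htop ?_
  rw [← posTrace_add (sub_nonneg.2 hST) hS, sub_add_cancel]

theorem posTrace_proj (ψ : K) : posTrace (proj ψ) = ‖ψ‖ₑ ^ 2 := by
  obtain ⟨w, b, -⟩ := exists_hilbertBasis ℂ K
  rw [posTrace_eq_tsum b (proj_nonneg ψ), ← tsum_enorm_inner_sq b ψ]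
  refine tsum_congr fun i => ?_
  rw [expectation_proj, ENNReal.ofReal_pow (norm_nonneg _), norm_inner_symm, ofReal_norm]

theorem enorm_le_posTrace {T : K →L[ℂ] K} (hT : 0 ≤ T) : ‖T‖ₑ ≤ posTrace T := by
  rcases eq_or_ne (posTrace T) ⊤ with htop | htop
  · rw [htop]
    exact le_top
  have hunit (x : K) (hx : ‖x‖ = 1) : ‖CFC.sqrt T x‖ ≤ √(posTrace T).toReal := by
    have hg : Orthonormal ℂ fun _ : Unit => x :=
      ⟨fun _ => hx, fun i j hij => absurd (Subsingleton.elim i j) hij⟩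
    have h := sum_ofReal_expectation_le_posTrace hg Finset.univ T
    rw [Finset.univ_unique, Finset.sum_singleton, expectation_eq_norm_sqrt_sq hT,
      ENNReal.ofReal_le_iff_le_toReal htop] at h
    exact Real.le_sqrt_of_sq_le h
  have hsqrt : √‖T‖ ≤ √(posTrace T).toReal :=
    CFC.norm_sqrt T hT ▸
      ContinuousLinearMap.opNorm_le_of_unit_norm (𝕜 := ℂ) (Real.sqrt_nonneg _) hunit
  rw [← ofReal_norm, ENNReal.ofReal_le_iff_le_toReal htop]
  exact (Real.sqrt_le_sqrt_iff ENNReal.toReal_nonneg).1 hsqrt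

theorem enorm_le_traceNorm (T : K →L[ℂ] K) : ‖T‖ₑ ≤ traceNorm T := by
  have h := enorm_le_posTrace (CFC.abs_nonneg T)
  rwa [← ofReal_norm, CFC.norm_abs, ofReal_norm] at h

theorem tendsto_of_tendsto_traceNorm_sub {α : Type*} {l : Filter α} {T : α → K →L[ℂ] K}
    {S : K →L[ℂ] K} (h : Tendsto (fun k => traceNorm (T k - S)) l (𝓝 0)) : Tendsto T l (𝓝 S) := by
  rw [tendsto_iff_edist_tendsto_0]
  refine tendsto_of_tendsto_of_tendsto_of_le_of_le tendsto_const_nhds h (fun _ => zero_le)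
    fun k => ?_
  rw [edist_eq_enorm_sub]
  exact enorm_le_traceNorm _

theorem exists_hilbertBasis_mem_or_mem_orthogonal (M : Submodule ℂ K) [CompleteSpace M] :
    ∃ (w : Set K) (b : HilbertBasis w ℂ K), ∀ i, b i ∈ M ∨ b i ∈ Mᗮ := by
  obtain ⟨v, c, -⟩ := exists_hilbertBasis ℂ M
  obtain ⟨w, b, hcw, hb⟩ :=
    (c.orthonormal.comp_linearIsometry M.subtypeₗᵢ).toSubtypeRange.exists_hilbertBasis_extension
  refine ⟨w, b, fun i => or_iff_not_imp_left.2 fun hi => (M.mem_orthogonal' _).2 fun m hm => ?_⟩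
  have hinner (j : v) : ⟪b i, (c j : K)⟫_ℂ = 0 := by
    have hj : (c j : K) ∈ w := hcw ⟨j, rfl⟩
    have hne : i ≠ ⟨c j, hj⟩ := by
      rintro rfl
      rw [hb] at hi
      exact hi (c j).2
    simpa [hb] using b.orthonormal.inner_eq_zero hne
  have hsum := (c.hasSum_repr ⟨m, hm⟩).mapL ((innerSL ℂ (b i)).comp M.subtypeL)
  simpa [hinner] using hsum.unique (hasSum_zero.congr_fun fun j => by simp [hinner])

theorem exists_hilbertBasis_apply_eq_zero {S T : K →L[ℂ] K} (hT : IsSelfAdjoint T)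
    (hST : S * T = 0) :
    ∃ (w : Set K) (b : HilbertBasis w ℂ K), ∀ i, S (b i) = 0 ∨ T (b i) = 0 := by
  have : CompleteSpace S.ker := S.isClosed_ker.completeSpace_coe
  obtain ⟨w, b, hb⟩ := exists_hilbertBasis_mem_or_mem_orthogonal S.ker
  refine ⟨w, b, fun i => (hb i).imp id fun hi => ?_⟩
  have hmem : T (T (b i)) ∈ S.ker := DFunLike.congr_fun hST (T (b i))
  rw [← inner_self_eq_zero (𝕜 := ℂ), hT.isSymmetric.apply_clm]
  exact (S.ker.mem_orthogonal' _).1 hi _ hmem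

-- An orthonormal basis adapted to the Jordan decomposition `T = T⁺ - T⁻`.
theorem exists_hilbertBasis_expectation_abs {T : K →L[ℂ] K} (hT : IsSelfAdjoint T) :
    ∃ (w : Set K) (b : HilbertBasis w ℂ K),
      ∀ i, expectation (b i) (CFC.abs T) = |expectation (b i) T| := by
  obtain ⟨w, b, hb⟩ := exists_hilbertBasis_apply_eq_zero
    (CFC.negPart_nonneg T).isSelfAdjoint (CFC.posPart_mul_negPart T)
  refine ⟨w, b, fun i => ?_⟩
  have hpos := expectation_nonneg (CFC.posPart_nonneg T) (b i)
  have hneg := expectation_nonneg (CFC.negPart_nonneg T) (b i)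
  have hsub : expectation (b i) T = expectation (b i) T⁺ - expectation (b i) T⁻ := by
    rw [← map_sub, CFC.posPart_sub_negPart T hT]
  rw [← CFC.posPart_add_negPart T hT, map_add, hsub]
  rcases hb i with h | h
  · have hzero : expectation (b i) T⁺ = 0 := by simp [expectation_apply, h]
    rw [hzero, zero_add, zero_sub, abs_neg, abs_of_nonneg hneg]
  · have hzero : expectation (b i) T⁻ = 0 := by simp [expectation_apply, h]
    rw [hzero, add_zero, sub_zero, abs_of_nonneg hpos]

theorem traceNorm_sub_le {P N : K →L[ℂ] K} (hP : 0 ≤ P) (hN : 0 ≤ N) :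
    traceNorm (P - N) ≤ posTrace P + posTrace N := by
  obtain ⟨w, b, hb⟩ := exists_hilbertBasis_expectation_abs
    (hP.isSelfAdjoint.sub hN.isSelfAdjoint)
  rw [← posTrace_add hP hN, traceNorm, posTrace_eq_tsum b (CFC.abs_nonneg _),
    posTrace_eq_tsum b (add_nonneg hP hN)]
  refine ENNReal.tsum_le_tsum fun i => ENNReal.ofReal_le_ofReal ?_
  rw [hb, map_sub, map_add, abs_sub_le_iff]
  constructor <;> linarith [expectation_nonneg hP (b i), expectation_nonneg hN (b i)]

end Trace

section DensityOperators

variable {K ι : Type*} [NormedAddCommGroup K] [InnerProductSpace ℂ K] [CompleteSpace K]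

theorem mem_densityOperators_iff {T : K →L[ℂ] K} :
    T ∈ densityOperators K ↔ 0 ≤ T ∧ posTrace T = 1 := by
  rw [ContinuousLinearMap.nonneg_iff_isPositive]
  rfl

theorem proj_mem_densityOperators {ψ : K} (hψ : ‖ψ‖ = 1) : proj ψ ∈ densityOperators K :=
  mem_densityOperators_iff.2 ⟨proj_nonneg ψ, by simp [posTrace_proj, ← ofReal_norm, hψ]⟩

theorem posTrace_of_hasSum_smul {T : ι → K →L[ℂ] K} {S : K →L[ℂ] K} {w : ι → ℝ} {p : ℝ}
    (hT : ∀ n, T n ∈ densityOperators K) (hw : ∀ n, 0 ≤ w n) (hp : HasSum w p)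
    (hS : HasSum (fun n => w n • T n) S) : posTrace S = ENNReal.ofReal p := by
  simp_rw [mem_densityOperators_iff] at hT
  rw [posTrace_of_hasSum (fun n => smul_nonneg (hw n) (hT n).1) hS, ← hp.tsum_eq,
    ENNReal.ofReal_tsum_of_nonneg hw hp.summable]
  exact tsum_congr fun n => by rw [posTrace_smul (hw n), (hT n).2, mul_one]

theorem posTrace_sum_smul {T : ι → K →L[ℂ] K} {w : ι → ℝ} (hT : ∀ n, T n ∈ densityOperators K)
    (hw : ∀ n, 0 ≤ w n) (s : Finset ι) :
    posTrace (∑ n ∈ s, w n • T n) = ENNReal.ofReal (∑ n ∈ s, w n) :=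
  posTrace_of_hasSum_smul (T := fun n : s => T n) (w := fun n : s => w n) (fun n => hT n)
    (fun n => hw n) (s.hasSum w) (s.hasSum fun n => w n • T n)

theorem hasSum_smul_mem_densityOperators {T : ι → K →L[ℂ] K} {S : K →L[ℂ] K} {w : ι → ℝ}
    (hT : ∀ n, T n ∈ densityOperators K) (hw : ∀ n, 0 ≤ w n) (hw1 : HasSum w 1)
    (hS : HasSum (fun n => w n • T n) S) : S ∈ densityOperators K :=
  mem_densityOperators_iff.2
    ⟨hS.nonneg fun n => smul_nonneg (hw n) (mem_densityOperators_iff.1 (hT n)).1,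
      by rw [posTrace_of_hasSum_smul hT hw hw1 hS, ENNReal.ofReal_one]⟩

end DensityOperators

section TraceClosedConvexHull

variable {K ι : Type*} [NormedAddCommGroup K] [InnerProductSpace ℂ K] [CompleteSpace K]
  {C : Set (K →L[ℂ] K)}

theorem traceClosedConvexHull_subset_closure :
    traceClosedConvexHull C ⊆ closure (convexHull ℝ C) := by
  intro T hT
  refine EMetric.mem_closure_iff.2 fun ε hε => ?_
  obtain ⟨S, hS, hTS⟩ := hT ε hε
  refine ⟨S, hS, ?_⟩
  rw [edist_eq_enorm_sub]
  exact (enorm_le_traceNorm _).trans_lt hTS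

theorem le_of_mem_traceClosedConvexHull {ℓ : (K →L[ℂ] K) →L[ℝ] ℝ} {c : ℝ}
    (hC : ∀ T ∈ C, ℓ T ≤ c) {T : K →L[ℂ] K} (hT : T ∈ traceClosedConvexHull C) : ℓ T ≤ c :=
  closure_minimal (convexHull_min hC (convex_halfSpace_le ℓ.toLinearMap.isLinear c))
    (isClosed_le ℓ.continuous continuous_const) (traceClosedConvexHull_subset_closure hT)

theorem traceNorm_sub_centerMass_le {T : ι → K →L[ℂ] K} {S : K →L[ℂ] K} {w : ι → ℝ}
    (hT : ∀ n, T n ∈ densityOperators K) (hw : ∀ n, 0 ≤ w n) (hw1 : HasSum w 1)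
    (hS : HasSum (fun n => w n • T n) S) {s : Finset ι} (hs : 0 < ∑ n ∈ s, w n) :
    traceNorm (S - s.centerMass w T) ≤ ENNReal.ofReal (2 * (1 - ∑ n ∈ s, w n)) := by
  set p := ∑ n ∈ s, w n with hp
  set R := ∑ n ∈ s, w n • T n with hR
  have hp1 : p ≤ 1 := sum_le_hasSum s (fun n _ => hw n) hw1
  have hpinv : 0 ≤ p⁻¹ - 1 := sub_nonneg.2 ((one_le_inv₀ hs).2 hp1)
  have hterm (n : ι) : 0 ≤ w n • T n := smul_nonneg (hw n) (mem_densityOperators_iff.1 (hT n)).1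
  have hR0 : 0 ≤ R := Finset.sum_nonneg fun n _ => hterm n
  have hRS : R ≤ S := sum_le_hasSum s (fun n _ => hterm n) hS
  have hR_trace : posTrace R = ENNReal.ofReal p := posTrace_sum_smul hT hw s
  calc traceNorm (S - s.centerMass w T)
      = traceNorm ((S - R) - (p⁻¹ - 1) • R) := by
        rw [Finset.centerMass, ← hp, ← hR, sub_smul, one_smul, sub_sub_sub_cancel_right]
    _ ≤ posTrace (S - R) + posTrace ((p⁻¹ - 1) • R) :=
        traceNorm_sub_le (sub_nonneg.2 hRS) (smul_nonneg hpinv hR0)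
    _ = ENNReal.ofReal (1 - p) + ENNReal.ofReal ((p⁻¹ - 1) * p) := by
        rw [posTrace_sub hR0 hRS (hR_trace ▸ ENNReal.ofReal_ne_top), posTrace_smul hpinv, hR_trace,
          posTrace_of_hasSum_smul hT hw hw1 hS, ← ENNReal.ofReal_sub _ hs.le,
          ← ENNReal.ofReal_mul hpinv]
    _ = ENNReal.ofReal (2 * (1 - p)) := by
        rw [← ENNReal.ofReal_add (sub_nonneg.2 hp1) (mul_nonneg hpinv hs.le), sub_mul,
          inv_mul_cancel₀ hs.ne', one_mul, two_mul]

theorem mem_traceClosedConvexHull_of_hasSum {T : ι → K →L[ℂ] K} {S : K →L[ℂ] K} {w : ι → ℝ}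
    (hT : ∀ n, T n ∈ densityOperators K) (hTC : ∀ n, T n ∈ C) (hw : ∀ n, 0 ≤ w n)
    (hw1 : HasSum w 1) (hS : HasSum (fun n => w n • T n) S) : S ∈ traceClosedConvexHull C := by
  intro ε hε
  have hlim : Tendsto (fun s : Finset ι => ENNReal.ofReal (2 * (1 - ∑ n ∈ s, w n))) atTop
      (𝓝 0) := by
    simpa using ENNReal.tendsto_ofReal ((hw1.const_sub 1).const_mul 2)
  obtain ⟨s, hs_small, hs_pos⟩ := ((hlim.eventually (gt_mem_nhds hε)).and
    (hw1.eventually (lt_mem_nhds one_pos))).exists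
  exact ⟨s.centerMass w T,
    s.centerMass_mem_convexHull (fun n _ => hw n) hs_pos fun n _ => hTC n,
    (traceNorm_sub_centerMass_le hT hw hw1 hS hs_pos).trans_lt hs_small⟩

end TraceClosedConvexHull

section Robustness

variable {K ι : Type*} [NormedAddCommGroup K] [InnerProductSpace ℂ K] [CompleteSpace K]

theorem robustness_le_plainRobustness (F : Set (K →L[ℂ] K)) (ρ : K →L[ℂ] K) :
    robustness F ρ ≤ plainRobustness F ρ := by
  refine sInf_le_sInf ?_
  rintro x ⟨r, hr, hx, τ, hτ, hmem⟩
  refine ⟨r, hr, hx, fun _ => ρ, fun _ => τ, ?_, fun _ => ⟨hτ, hmem⟩⟩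
  have hzero : traceNorm (0 : K →L[ℂ] K) = 0 := by simp [traceNorm, posTrace]
  simpa only [sub_self, hzero] using tendsto_const_nhds

theorem ofReal_le_robustness_of_witness {F : Set (K →L[ℂ] K)} {ℓ : (K →L[ℂ] K) →L[ℝ] ℝ}
    (hℓ : ∀ T, 0 ≤ T → 0 ≤ ℓ T) (hF : ∀ T ∈ F, ℓ T ≤ 1) (ρ : K →L[ℂ] K) :
    ENNReal.ofReal (ℓ ρ) ≤ robustness F ρ := by
  refine le_sInf ?_
  rintro x ⟨r, hr, rfl, ξ, τ, hξ, hmem⟩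
  refine ENNReal.ofReal_le_ofReal ?_
  refine le_of_tendsto ((ℓ.continuous.tendsto ρ).comp (tendsto_of_tendsto_traceNorm_sub hξ))
    (Eventually.of_forall fun k => ?_)
  obtain ⟨hτ, hfree⟩ := hmem k
  have hτ_nonneg := hℓ (τ k) (mem_densityOperators_iff.1 hτ).1
  have hle := hF _ hfree
  rw [← Complex.ofReal_inv, Complex.coe_smul, Complex.coe_smul, map_smul, map_add, map_smul,
    smul_eq_mul, smul_eq_mul, inv_mul_le_one₀ (by positivity)] at hle
  calc ℓ (ξ k) ≤ ℓ (ξ k) + r * ℓ (τ k) := le_add_of_nonneg_right (mul_nonneg hr hτ_nonneg)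
    _ ≤ 1 + r := hle

theorem plainRobustness_le_of_mem {F : Set (K →L[ℂ] K)} {ρ τ σ : K →L[ℂ] K} {r : ℝ}
    (hr : 0 ≤ r) (hτ : τ ∈ densityOperators K) (hσ : σ ∈ F) (h : (1 + r) • σ = ρ + r • τ) :
    plainRobustness F ρ ≤ ENNReal.ofReal (1 + r) := by
  refine sInf_le ⟨r, hr, rfl, τ, hτ, ?_⟩
  rw [← Complex.ofReal_inv, Complex.coe_smul, Complex.coe_smul, ← h,
    inv_smul_smul₀ (by positivity)]
  exact hσ

theorem eq_of_le_of_mem_densityOperators {S T : K →L[ℂ] K} (hS : S ∈ densityOperators K)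
    (hT : T ∈ densityOperators K) (hST : S ≤ T) : S = T := by
  obtain ⟨hS0, hS1⟩ := mem_densityOperators_iff.1 hS
  have hzero : posTrace (T - S) = 0 := by
    rw [posTrace_sub hS0 hST (by simp [hS1]), hS1, (mem_densityOperators_iff.1 hT).2, tsub_self]
  have hnorm := enorm_le_posTrace (sub_nonneg.2 hST)
  rw [hzero, le_zero_iff, enorm_eq_zero, sub_eq_zero] at hnorm
  exact hnorm.symm

theorem plainRobustness_le_of_le_smul {F : Set (K →L[ℂ] K)} {ρ σ : K →L[ℂ] K} {M : ℝ}
    (hρ : ρ ∈ densityOperators K) (hσ : σ ∈ densityOperators K) (hσF : σ ∈ F) (hM : 0 ≤ M)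
    (hle : ρ ≤ M • σ) : plainRobustness F ρ ≤ ENNReal.ofReal M := by
  obtain ⟨hρ0, hρ1⟩ := mem_densityOperators_iff.1 hρ
  have hσ1 : posTrace σ = 1 := hσ.2
  have hM1 : 1 ≤ M := by
    have htrace := posTrace_mono hle
    rwa [posTrace_smul hM, hρ1, hσ1, mul_one, ENNReal.one_le_ofReal] at htrace
  rcases hM1.eq_or_lt with rfl | hM1
  · rw [one_smul] at hle
    have heq : ρ = σ := eq_of_le_of_mem_densityOperators hρ hσ hle
    simpa using plainRobustness_le_of_mem (r := 0) le_rfl hρ hσF (by simp [heq])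
  have hr : 0 < M - 1 := sub_pos.2 hM1
  have hr_inv : 0 ≤ (M - 1)⁻¹ := inv_nonneg.2 hr.le
  have hτ : (M - 1)⁻¹ • (M • σ - ρ) ∈ densityOperators K := by
    refine mem_densityOperators_iff.2 ⟨smul_nonneg hr_inv (sub_nonneg.2 hle), ?_⟩
    rw [posTrace_smul hr_inv, posTrace_sub hρ0 hle (by simp [hρ1]), posTrace_smul hM, hρ1, hσ1,
      mul_one, ← ENNReal.ofReal_one, ← ENNReal.ofReal_sub _ zero_le_one,
      ← ENNReal.ofReal_mul hr_inv, inv_mul_cancel₀ hr.ne']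
  simpa using plainRobustness_le_of_mem hr.le hτ hσF
    (by rw [smul_inv_smul₀ hr.ne', add_sub_cancel, add_sub_cancel])

theorem norm_sum_mul_sq_le (c z : ι → ℂ) (s : Finset ι) :
    ‖∑ n ∈ s, c n * z n‖ ^ 2 ≤ (∑ n ∈ s, ‖c n‖) * ∑ n ∈ s, ‖c n‖ * ‖z n‖ ^ 2 :=
  calc ‖∑ n ∈ s, c n * z n‖ ^ 2 ≤ (∑ n ∈ s, ‖c n * z n‖) ^ 2 := by
        gcongr
        exact norm_sum_le _ _
    _ ≤ (∑ n ∈ s, ‖c n‖) * ∑ n ∈ s, ‖c n‖ * ‖z n‖ ^ 2 :=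
        Finset.sum_sq_le_sum_mul_sum_of_sq_le_mul s (fun _ _ => norm_nonneg _)
          (fun _ _ => by positivity) fun n _ => by
            rw [norm_mul]
            exact le_of_eq (by ring)

theorem proj_le_smul_of_hasSum {g : ι → K} {c : ι → ℂ} {ψ : K} {S : K →L[ℂ] K} {M : ℝ}
    (hM : HasSum (fun n => ‖c n‖) M) (hψ : HasSum (fun n => c n • g n) ψ)
    (hS : HasSum (fun n => ‖c n‖ • proj (g n)) S) : proj ψ ≤ M • S := by
  have hterm (n : ι) : 0 ≤ ‖c n‖ • proj (g n) := smul_nonneg (norm_nonneg _) (proj_nonneg _)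
  have hMS : 0 ≤ M • S :=
    smul_nonneg (hM.nonneg fun n => norm_nonneg _) (hS.nonneg hterm)
  refine le_of_expectation_le (proj_nonneg ψ).isSelfAdjoint hMS.isSelfAdjoint fun x => ?_
  have hlhs := (hψ.mapL (innerSL ℂ x)).norm.pow 2
  have hrhs := Tendsto.mul hM (hS.mapL (expectation x))
  rw [map_smul, smul_eq_mul, expectation_proj, norm_inner_symm]
  refine le_of_tendsto_of_tendsto' hlhs hrhs fun s => ?_
  simp only [innerSL_apply_apply, map_smul, smul_eq_mul, expectation_proj,
    norm_inner_symm _ x]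
  exact norm_sum_mul_sq_le c _ s

theorem plainRobustness_traceClosedConvexHull_proj_le {C : Set (K →L[ℂ] K)} {g : ι → K}
    {c : ι → ℂ} {ψ : K} {M : ℝ} (hg : ∀ n, ‖g n‖ = 1) (hgC : ∀ n, proj (g n) ∈ C)
    (hM : HasSum (fun n => ‖c n‖) M) (hψ : HasSum (fun n => c n • g n) ψ) (hψ1 : ‖ψ‖ = 1) :
    plainRobustness (traceClosedConvexHull C) (proj ψ) ≤ ENNReal.ofReal (M ^ 2) := by
  have hM1 : 1 ≤ M := hψ1 ▸ hψ.norm_le_of_bounded hM fun n => by rw [norm_smul, hg, mul_one]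
  have hM0 : 0 < M := one_pos.trans_le hM1
  have hdensity (n : ι) := proj_mem_densityOperators (hg n)
  have hS : Summable fun n => ‖c n‖ • proj (g n) := by
    refine .of_norm (hM.summable.congr fun n => ?_)
    rw [norm_smul, norm_norm, proj, InnerProductSpace.norm_rankOne, hg, mul_one, mul_one]
  have hweight (n : ι) : 0 ≤ M⁻¹ * ‖c n‖ := by positivity
  have hweight_sum : HasSum (fun n => M⁻¹ * ‖c n‖) 1 := by
    simpa [hM0.ne'] using hM.mul_left M⁻¹
  have hσ : HasSum (fun n => (M⁻¹ * ‖c n‖) • proj (g n)) (M⁻¹ • ∑' n, ‖c n‖ • proj (g n)) := by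
    simpa only [mul_smul] using hS.hasSum.const_smul M⁻¹
  refine plainRobustness_le_of_le_smul (proj_mem_densityOperators hψ1)
    (hasSum_smul_mem_densityOperators hdensity hweight hweight_sum hσ)
    (mem_traceClosedConvexHull_of_hasSum hdensity hgC hweight hweight_sum hσ) (sq_nonneg M) ?_
  rw [smul_smul, sq, mul_inv_cancel_right₀ hM0.ne']
  exact proj_le_smul_of_hasSum hM hψ hS.hasSum

end Robustness

section OrthonormalExpansion

variable {K ι : Type*} [NormedAddCommGroup K] [InnerProductSpace ℂ K] {g : ι → K} {c : ι → ℂ}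
  {x : K}

theorem inner_eq_of_hasSum_smul (hg : Orthonormal ℂ g) (hx : HasSum (fun n => c n • g n) x)
    (n : ι) : ⟪g n, x⟫_ℂ = c n := by
  classical
  refine (hx.mapL (innerSL ℂ (g n))).unique ((hasSum_ite_eq n (c n)).congr_fun fun m => ?_)
  rw [innerSL_apply_apply, inner_smul_right, orthonormal_iff_ite.1 hg, mul_ite, mul_one, mul_zero]
  grind

theorem hasSum_norm_sq_of_hasSum_smul (hg : Orthonormal ℂ g)
    (hx : HasSum (fun n => c n • g n) x) : HasSum (fun n => ‖c n‖ ^ 2) (‖x‖ ^ 2) := by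
  have hinner := Complex.hasSum_re (hx.mapL (innerSL ℂ x))
  rw [innerSL_apply_apply, inner_self_eq_norm_sq_to_K] at hinner
  convert hinner using 1
  · ext n
    rw [innerSL_apply_apply, inner_smul_right, ← inner_conj_symm, inner_eq_of_hasSum_smul hg hx,
      Complex.mul_conj']
    norm_cast
  · norm_cast

theorem orthonormal_smul_of_norm_eq_one (hg : Orthonormal ℂ g) (hc : ∀ n, ‖c n‖ = 1) :
    Orthonormal ℂ fun n => c n • g n :=
  ⟨fun n => by rw [norm_smul, hc, hg.norm_eq_one, mul_one],
    fun m n hmn => by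
      beta_reduce
      rw [inner_smul_left, inner_smul_right, hg.inner_eq_zero hmn, mul_zero, mul_zero]⟩

end OrthonormalExpansion

section Schmidt

variable {A B ι : Type*} [NormedAddCommGroup A] [InnerProductSpace ℂ A]
  [NormedAddCommGroup B] [InnerProductSpace ℂ B] {e : ι → A} {f : ι → B}

theorem inner_tensorVec (a a' : A) (b b' : B) :
    ⟪tensorVec a b, tensorVec a' b'⟫_ℂ = ⟪a, a'⟫_ℂ * ⟪b, b'⟫_ℂ := by
  rw [tensorVec, tensorVec, UniformSpace.Completion.inner_coe, TensorProduct.inner_tmul]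

theorem norm_tensorVec (a : A) (b : B) : ‖tensorVec a b‖ = ‖a‖ * ‖b‖ := by
  rw [tensorVec, UniformSpace.Completion.norm_coe, TensorProduct.norm_tmul]

theorem smul_tensorVec (z : ℂ) (a : A) (b : B) : tensorVec (z • a) b = z • tensorVec a b := by
  rw [tensorVec, ← TensorProduct.smul_tmul', UniformSpace.Completion.coe_smul, tensorVec]

theorem orthonormal_tensorVec (he : Orthonormal ℂ e) (hf : Orthonormal ℂ f) :
    Orthonormal ℂ fun n => tensorVec (e n) (f n) :=
  ⟨fun n => by rw [norm_tensorVec, he.norm_eq_one, hf.norm_eq_one, mul_one],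
    fun m n hmn => by
      beta_reduce
      rw [inner_tensorVec, he.inner_eq_zero hmn, zero_mul]⟩

theorem norm_inner_sum_tensorVec_le (he : Orthonormal ℂ e) (hf : Orthonormal ℂ f) (s : Finset ι)
    (a : A) (b : B) : ‖⟪tensorVec a b, ∑ n ∈ s, tensorVec (e n) (f n)⟫_ℂ‖ ≤ ‖a‖ * ‖b‖ := by
  simp_rw [inner_sum, inner_tensorVec]
  calc ‖∑ n ∈ s, ⟪a, e n⟫_ℂ * ⟪b, f n⟫_ℂ‖ ≤ ∑ n ∈ s, ‖⟪e n, a⟫_ℂ‖ * ‖⟪f n, b⟫_ℂ‖ := by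
        simp_rw [norm_inner_symm (e _), norm_inner_symm (f _), ← norm_mul]
        exact norm_sum_le _ _
    _ ≤ √(∑ n ∈ s, ‖⟪e n, a⟫_ℂ‖ ^ 2) * √(∑ n ∈ s, ‖⟪f n, b⟫_ℂ‖ ^ 2) :=
        Real.sum_mul_le_sqrt_mul_sqrt _ _ _
    _ ≤ √(‖a‖ ^ 2) * √(‖b‖ ^ 2) := by
        gcongr
        · exact he.sum_inner_products_le a
        · exact hf.sum_inner_products_le b
    _ = ‖a‖ * ‖b‖ := by rw [Real.sqrt_sq (norm_nonneg a), Real.sqrt_sq (norm_nonneg b)]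

theorem expectation_sum_tensorVec_le_one (he : Orthonormal ℂ e) (hf : Orthonormal ℂ f)
    (s : Finset ι) {σ : HilbertTensor A B →L[ℂ] HilbertTensor A B}
    (hσ : σ ∈ separableStates A B) : expectation (∑ n ∈ s, tensorVec (e n) (f n)) σ ≤ 1 := by
  refine le_of_mem_traceClosedConvexHull ?_ hσ
  rintro _ ⟨a, b, ha, hb, rfl⟩
  rw [expectation_proj]
  refine pow_le_one₀ (norm_nonneg _) ?_
  simpa only [ha, hb, mul_one] using norm_inner_sum_tensorVec_le he hf s a b

namespace IsSchmidtDecomposition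

variable {ψ : HilbertTensor A B} {μ : ι → ℝ}

theorem expectation_proj_sum_tensorVec (h : IsSchmidtDecomposition ψ μ e f) (s : Finset ι) :
    expectation (∑ n ∈ s, tensorVec (e n) (f n)) (proj ψ) = (∑ n ∈ s, μ n) ^ 2 := by
  have hg := orthonormal_tensorVec h.orthonormal_left h.orthonormal_right
  rw [expectation_proj, norm_inner_symm, sum_inner,
    Finset.sum_congr rfl fun n _ => inner_eq_of_hasSum_smul hg h.hasSum n, ← Complex.ofReal_sum,
    Complex.norm_real, Real.norm_eq_abs, sq_abs]

theorem le_robustness (h : IsSchmidtDecomposition ψ μ e f) :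
    (∑' n, ENNReal.ofReal (μ n)) ^ 2 ≤ robustness (separableStates A B) (proj ψ) := by
  rw [ENNReal.tsum_eq_iSup_sum, ENNReal.iSup_pow]
  refine iSup_le fun s => ?_
  rw [← ENNReal.ofReal_sum_of_nonneg fun n _ => h.nonneg n,
    ← ENNReal.ofReal_pow (Finset.sum_nonneg fun n _ => h.nonneg n),
    ← h.expectation_proj_sum_tensorVec s]
  exact ofReal_le_robustness_of_witness (fun T hT => expectation_nonneg hT _)
    (fun σ hσ => expectation_sum_tensorVec_le_one h.orthonormal_left h.orthonormal_right s hσ) _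

theorem summable_iff (h : IsSchmidtDecomposition ψ μ e f) :
    Summable μ ↔ ∑' n, ENNReal.ofReal (μ n) ≠ ⊤ :=
  ⟨Summable.tsum_ofReal_ne_top, fun htop => (ENNReal.summable_toReal htop).congr fun n =>
    ENNReal.toReal_ofReal (h.nonneg n)⟩

theorem plainRobustness_le (h : IsSchmidtDecomposition ψ μ e f) (hψ : ‖ψ‖ = 1) :
    plainRobustness (separableStates A B) (proj ψ) ≤ (∑' n, ENNReal.ofReal (μ n)) ^ 2 := by
  by_cases hμ : Summable μ
  · have hnorm (n : ι) : ‖(μ n : ℂ)‖ = μ n := by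
      rw [Complex.norm_real, Real.norm_of_nonneg (h.nonneg n)]
    rw [← ENNReal.ofReal_tsum_of_nonneg h.nonneg hμ, ← ENNReal.ofReal_pow (tsum_nonneg h.nonneg)]
    exact plainRobustness_traceClosedConvexHull_proj_le
      (orthonormal_tensorVec h.orthonormal_left h.orthonormal_right).1
      (fun n => ⟨e n, f n, h.orthonormal_left.1 n, h.orthonormal_right.1 n, rfl⟩)
      (by simpa only [hnorm] using hμ.hasSum) h.hasSum hψ
  · rw [h.summable_iff, not_not] at hμ
    simp [hμ]

theorem robustness_eq (h : IsSchmidtDecomposition ψ μ e f) (hψ : ‖ψ‖ = 1) :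
    robustness (separableStates A B) (proj ψ) = (∑' n, ENNReal.ofReal (μ n)) ^ 2 :=
  le_antisymm ((robustness_le_plainRobustness _ _).trans (h.plainRobustness_le hψ)) h.le_robustness

theorem plainRobustness_eq (h : IsSchmidtDecomposition ψ μ e f) (hψ : ‖ψ‖ = 1) :
    plainRobustness (separableStates A B) (proj ψ) = (∑' n, ENNReal.ofReal (μ n)) ^ 2 :=
  le_antisymm (h.plainRobustness_le hψ) (h.le_robustness.trans (robustness_le_plainRobustness _ _))

theorem robustness_lt_top_iff (h : IsSchmidtDecomposition ψ μ e f) (hψ : ‖ψ‖ = 1) :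
    robustness (separableStates A B) (proj ψ) < ⊤ ↔ Summable μ := by
  rw [h.robustness_eq hψ, h.summable_iff, lt_top_iff_ne_top, Ne, ENNReal.pow_eq_top_iff]
  simp

end IsSchmidtDecomposition

theorem exists_isSchmidtDecomposition_of_hasSum {c : ι → ℂ} {ψ : HilbertTensor A B}
    (he : Orthonormal ℂ e) (hf : Orthonormal ℂ f)
    (hψ : HasSum (fun n => c n • tensorVec (e n) (f n)) ψ) :
    ∃ e' : ι → A, IsSchmidtDecomposition ψ (fun n => ‖c n‖) e' f := by
  refine ⟨fun n => Complex.exp ((c n).arg * Complex.I) • e n, fun n => norm_nonneg _,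
    orthonormal_smul_of_norm_eq_one he fun n => Complex.norm_exp_ofReal_mul_I _, hf,
    hψ.congr_fun fun n => ?_⟩
  rw [smul_tensorVec, smul_smul, Complex.norm_mul_exp_arg_mul_I]

end Schmidt

section TwoModeSqueezedVacuum

theorem abs_tanh (x : ℝ) : |Real.tanh x| = Real.tanh |x| := by
  rw [Real.tanh_eq_sinh_div_cosh, abs_div, Real.abs_sinh, abs_of_pos (Real.cosh_pos x),
    ← Real.cosh_abs, ← Real.tanh_eq_sinh_div_cosh]

theorem hasSum_abs_tanh_pow_div_cosh (x : ℝ) :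
    HasSum (fun n : ℕ => |Real.tanh x ^ n / Real.cosh x|) (Real.exp |x|) := by
  have hlimit : (1 - Real.tanh |x|)⁻¹ / Real.cosh |x| = Real.exp |x| := by
    have hcosh := (Real.cosh_pos |x|).ne'
    rw [div_eq_mul_inv, ← mul_inv, sub_mul, Real.tanh_eq_sinh_div_cosh, div_mul_cancel₀ _ hcosh,
      one_mul, Real.cosh_sub_sinh, Real.exp_neg, inv_inv]
  have hgeom := (hasSum_geometric_of_lt_one (abs_tanh x ▸ abs_nonneg _)
    (Real.tanh_lt_one |x|)).div_const (Real.cosh |x|)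
  rw [hlimit] at hgeom
  refine hgeom.congr_fun fun n => ?_
  rw [abs_div, abs_pow, abs_tanh, abs_of_pos (Real.cosh_pos x), Real.cosh_abs]

theorem hasSum_tanh_pow_div_cosh_sq (x : ℝ) :
    HasSum (fun n : ℕ => (Real.tanh x ^ n / Real.cosh x) ^ 2) 1 := by
  have hlimit : (1 - Real.tanh x ^ 2)⁻¹ / Real.cosh x ^ 2 = 1 := by
    have hcosh := pow_ne_zero 2 (Real.cosh_pos x).ne'
    rw [div_eq_mul_inv, ← mul_inv, sub_mul, Real.tanh_eq_sinh_div_cosh, div_pow,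
      div_mul_cancel₀ _ hcosh, one_mul, Real.cosh_sq_sub_sinh_sq, inv_one]
  have hgeom := (hasSum_geometric_of_lt_one (sq_nonneg (Real.tanh x))
    (Real.tanh_sq_lt_one x)).div_const (Real.cosh x ^ 2)
  rw [hlimit] at hgeom
  exact hgeom.congr_fun fun n => by rw [div_pow, pow_right_comm]

variable {A B : Type*} [NormedAddCommGroup A] [InnerProductSpace ℂ A]
  [NormedAddCommGroup B] [InnerProductSpace ℂ B]
  (b₁ : HilbertBasis ℕ ℂ A) (b₂ : HilbertBasis ℕ ℂ B) (r : ℝ)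

theorem hasSum_twoModeSqueezedVacuum :
    HasSum (fun n => ((Real.tanh (r / 2) ^ n / Real.cosh (r / 2) : ℝ) : ℂ) •
      tensorVec (b₁ n) (b₂ n)) (twoModeSqueezedVacuum b₁ b₂ r) := by
  refine Summable.hasSum (.of_norm ?_)
  refine (hasSum_abs_tanh_pow_div_cosh (r / 2)).summable.congr fun n => ?_
  rw [norm_smul, (orthonormal_tensorVec b₁.orthonormal b₂.orthonormal).norm_eq_one, mul_one,
    Complex.norm_real, Real.norm_eq_abs]

theorem norm_twoModeSqueezedVacuum : ‖twoModeSqueezedVacuum b₁ b₂ r‖ = 1 := by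
  have hsq := hasSum_norm_sq_of_hasSum_smul
    (orthonormal_tensorVec b₁.orthonormal b₂.orthonormal) (hasSum_twoModeSqueezedVacuum b₁ b₂ r)
  simp only [Complex.norm_real, Real.norm_eq_abs, sq_abs] at hsq
  exact (pow_eq_one_iff_of_nonneg (norm_nonneg _) two_ne_zero).1
    (hsq.unique (hasSum_tanh_pow_div_cosh_sq _))

theorem exists_isSchmidtDecomposition_twoModeSqueezedVacuum :
    ∃ e : ℕ → A, IsSchmidtDecomposition (twoModeSqueezedVacuum b₁ b₂ r)
      (fun n => |Real.tanh (r / 2) ^ n / Real.cosh (r / 2)|) e b₂ := by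
  simpa only [Complex.norm_real, Real.norm_eq_abs] using exists_isSchmidtDecomposition_of_hasSum
    b₁.orthonormal b₂.orthonormal (hasSum_twoModeSqueezedVacuum b₁ b₂ r)

theorem sq_tsum_ofReal_abs_tanh_pow_div_cosh :
    (∑' n : ℕ, ENNReal.ofReal |Real.tanh (r / 2) ^ n / Real.cosh (r / 2)|) ^ 2 =
      ENNReal.ofReal (Real.exp |r|) := by
  have hsum := hasSum_abs_tanh_pow_div_cosh (r / 2)
  rw [← ENNReal.ofReal_tsum_of_nonneg (fun _ => abs_nonneg _) hsum.summable, hsum.tsum_eq,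
    ← ENNReal.ofReal_pow (Real.exp_pos _).le, ← Real.exp_nat_mul, abs_div, Nat.abs_ofNat,
    Nat.cast_ofNat, mul_div_cancel₀ _ two_ne_zero]

end TwoModeSqueezedVacuum

end QuantumRobustness

theorem mainTheorem5_general {A B : Type*}
    [NormedAddCommGroup A] [InnerProductSpace ℂ A]
    [NormedAddCommGroup B] [InnerProductSpace ℂ B] :
    (∀ {ι : Type*} (ψ : QuantumRobustness.HilbertTensor A B) (μ : ι → ℝ) (e : ι → A) (f : ι → B),
      ‖ψ‖ = 1 → QuantumRobustness.IsSchmidtDecomposition ψ μ e f →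
        QuantumRobustness.robustness (QuantumRobustness.separableStates A B)
            (QuantumRobustness.proj ψ) = (∑' n, ENNReal.ofReal (μ n)) ^ 2 ∧
        QuantumRobustness.plainRobustness (QuantumRobustness.separableStates A B)
            (QuantumRobustness.proj ψ) = (∑' n, ENNReal.ofReal (μ n)) ^ 2 ∧
        (QuantumRobustness.robustness (QuantumRobustness.separableStates A B)
            (QuantumRobustness.proj ψ) < ⊤ ↔ Summable μ)) ∧
    (∀ (b₁ : HilbertBasis ℕ ℂ A) (b₂ : HilbertBasis ℕ ℂ B) (r : ℝ),
      ‖QuantumRobustness.twoModeSqueezedVacuum b₁ b₂ r‖ = 1 ∧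
      QuantumRobustness.robustness (QuantumRobustness.separableStates A B)
          (QuantumRobustness.proj (QuantumRobustness.twoModeSqueezedVacuum b₁ b₂ r)) =
        ENNReal.ofReal (Real.exp |r|) ∧
      QuantumRobustness.plainRobustness (QuantumRobustness.separableStates A B)
          (QuantumRobustness.proj (QuantumRobustness.twoModeSqueezedVacuum b₁ b₂ r)) =
        ENNReal.ofReal (Real.exp |r|)) := by
  refine ⟨fun ψ μ e f hψ h => ⟨h.robustness_eq hψ, h.plainRobustness_eq hψ,
    h.robustness_lt_top_iff hψ⟩, fun b₁ b₂ r => ?_⟩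
  obtain ⟨e, h⟩ := QuantumRobustness.exists_isSchmidtDecomposition_twoModeSqueezedVacuum b₁ b₂ r
  have hν := QuantumRobustness.norm_twoModeSqueezedVacuum b₁ b₂ r
  rw [h.robustness_eq hν, h.plainRobustness_eq hν,
    QuantumRobustness.sq_tsum_ofReal_abs_tanh_pow_div_cosh]
  exact ⟨hν, rfl, rfl⟩

theorem mainTheorem5 {A B : Type*}
    [NormedAddCommGroup A] [InnerProductSpace ℂ A] [CompleteSpace A]
    [NormedAddCommGroup B] [InnerProductSpace ℂ B] [CompleteSpace B] :
    (∀ {ι : Type*} (ψ : QuantumRobustness.HilbertTensor A B) (μ : ι → ℝ) (e : ι → A) (f : ι → B),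
      ‖ψ‖ = 1 → QuantumRobustness.IsSchmidtDecomposition ψ μ e f →
        QuantumRobustness.robustness (QuantumRobustness.separableStates A B)
            (QuantumRobustness.proj ψ) = (∑' n, ENNReal.ofReal (μ n)) ^ 2 ∧
        QuantumRobustness.plainRobustness (QuantumRobustness.separableStates A B)
            (QuantumRobustness.proj ψ) = (∑' n, ENNReal.ofReal (μ n)) ^ 2 ∧
        (QuantumRobustness.robustness (QuantumRobustness.separableStates A B)
            (QuantumRobustness.proj ψ) < ⊤ ↔ Summable μ)) ∧
    (∀ (b₁ : HilbertBasis ℕ ℂ A) (b₂ : HilbertBasis ℕ ℂ B) (r : ℝ), 0 ≤ r →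
      ‖QuantumRobustness.twoModeSqueezedVacuum b₁ b₂ r‖ = 1 ∧
      QuantumRobustness.robustness (QuantumRobustness.separableStates A B)
          (QuantumRobustness.proj (QuantumRobustness.twoModeSqueezedVacuum b₁ b₂ r)) =
        ENNReal.ofReal (Real.exp r) ∧
      QuantumRobustness.plainRobustness (QuantumRobustness.separableStates A B)
          (QuantumRobustness.proj (QuantumRobustness.twoModeSqueezedVacuum b₁ b₂ r)) =
        ENNReal.ofReal (Real.exp r)) :=
  mainTheorem5_general.imp_right fun h b₁ b₂ r hr => by
    simpa only [abs_of_nonneg hr] using h b₁ b₂ r
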